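/- **Theorem (exact recovery for bounded basis functions).** There is a universal constant $C>0$ such that the following holds. Let $n,m,T\ge 1$ be integers, let $f:\mathbb{R}^n\to\mathbb{R}^m$ be measurable and $\bar A\in\mathbb{R}^{n\times m}$, and consider the system $$x_0=0,\qquad x_{t+1}=\bar A f(x_t)+\bar d_t,\quad t=0,\dots,T-1,$$ driven by random vectors $\bar d_0,\dots,\bar d_{T-1}\in\mathbb{R}^n$ on a probability space. Let $\mathcal F_t=\sigma(x_0,\dots,x_t)$ and let $p\in(0,1)$, $B>0$, $\lambda>0$. Assume that for every $t\in\{0,\dots,T-1\}$: 1. (probabilistic attack model) the event $\{\bar d_t\ne 0\}$ has probability $p$ and is independent of $\mathcal F_t$ (in particular, the attack events at different times are mutually independent); 2. (bounded basis function) $\|f(x)\|_\infty\le B$ for all $x\in\mathbb{R}^n$; 3. (stealthy attacks) $\mathbb{E}\big[\bar d_t/\|\bar d_t\|_2 \,\big|\, \mathcal F_t,\ \bar d_t\ne 0\big]=0$ almost surely; 4. (non-degeneracy) almost surely, $\lambda_{\min}\big(\mathbb{E}\big[f(x+\bar d_t)f(x+\bar d_t)^\top \,\big|\, \mathcal F_t,\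 \bar d_t\ne 0\big]\big)\ge\lambda^2$ for all $x\in\mathbb{R}^n$, the expectation being with respect to a regular conditional law of $\bar d_t$. Set $\kappa=B/\lambda$. Then $\kappa\ge 1$, and for every $\delta\in(0,1]$ such that $$T\ \ge\ C\,\frac{m^2\kappa^4}{p(1-p)^2}\left[mn\log\!\left(\frac{m\kappa}{p(1-p)}\right)+\log\!\left(\frac1\delta\right)\right],$$ with probability at least $1-\delta$ the matrix $\bar A$ is the unique global minimizer over $A\in\mathbb{R}^{n\times m}$ of the loss $\sum_{t=0}^{T-1}\|x_{t+1}-Af(x_t)\|_2$. -/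

import Mathlib

open MeasureTheory ProbabilityTheory

/-- `ℝᵏ` with its Euclidean norm. -/
abbrev Vec (k : ℕ) : Type := EuclideanSpace ℝ (Fin k)

section Dynamics

variable {n m : ℕ}

/-- The matrix-vector product `A v`, as a Euclidean vector. -/
noncomputable def matVec (A : Matrix (Fin n) (Fin m) ℝ) (v : Vec m) : Vec n :=
  WithLp.toLp 2 (A.mulVec v.ofLp)

/-- The trajectory `x₀ = 0`, `x_{t+1} = A f(x_t) + d_t` of a given attack sequence. -/
noncomputable def trajectory (A : Matrix (Fin n) (Fin m) ℝ) (f : Vec n → Vec m)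
    (d : ℕ → Vec n) : ℕ → Vec n
  | 0 => 0
  | t + 1 => matVec A (f (trajectory A f d t)) + d t

/-- The loss `∑_{t < T} ‖x_{t+1} - A f(x_t)‖₂` of a candidate matrix `A` on an observed
trajectory `x`. -/
noncomputable def loss (f : Vec n → Vec m) (x : ℕ → Vec n) (T : ℕ)
    (A : Matrix (Fin n) (Fin m) ℝ) : ℝ :=
  ∑ t ∈ Finset.range T, ‖x (t + 1) - matVec A (f (x t))‖

/-- `a` is the one and only global minimizer of `g`. -/
def IsUniqueGlobalMin {α : Type*} (g : α → ℝ) (a : α) : Prop :=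
  {b | ∀ c, g b ≤ g c} = {a}

end Dynamics

section Model

variable {n m : ℕ} {Ω : Type*}

/-- The random state `x_t` of the system driven by the random attacks `d`. -/
noncomputable def state (A : Matrix (Fin n) (Fin m) ℝ) (f : Vec n → Vec m)
    (d : ℕ → Ω → Vec n) (t : ℕ) (ω : Ω) : Vec n :=
  trajectory A f (fun s => d s ω) t

/-- The observed past `(x_0, …, x_t)`. -/
noncomputable def history (A : Matrix (Fin n) (Fin m) ℝ) (f : Vec n → Vec m)
    (d : ℕ → Ω → Vec n) (t : ℕ) (ω : Ω) : Fin (t + 1) → Vec n :=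
  fun s => state A f d s ω

/-- The sigma-algebra `σ(x_0, …, x_t)`. -/
@[reducible] noncomputable def pastSigma (A : Matrix (Fin n) (Fin m) ℝ) (f : Vec n → Vec m)
    (d : ℕ → Ω → Vec n) (t : ℕ) : MeasurableSpace Ω :=
  MeasurableSpace.comap (history A f d t) inferInstance

/-- The event that an attack takes place at time `t`. -/
def attackEvent (d : ℕ → Ω → Vec n) (t : ℕ) : Set Ω := {ω | d t ω ≠ 0}

/-- The normalized attack `d_t / ‖d_t‖₂` (only used on the event that `d_t ≠ 0`). -/
noncomputable def attackDirection (d : ℕ → Ω → Vec n) (t : ℕ) (ω : Ω) : Vec n :=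
  ‖d t ω‖⁻¹ • d t ω

/-- Bounded basis function: `‖f(x)‖_∞ ≤ B` for every `x`. -/
def BoundedBasis (f : Vec n → Vec m) (B : ℝ) : Prop :=
  ∀ x i, |f x i| ≤ B

variable [MeasurableSpace Ω]

/-- Probabilistic attack model on the horizon `t < T`: an attack takes place at each time with
probability `p`, independently of the past of the system.  (The past determines the earlier attack
vectors, so the attack events of different times are mutually independent.) -/
structure ProbabilisticAttack (μ : Measure Ω) (A : Matrix (Fin n) (Fin m) ℝ)
    (f : Vec n → Vec m) (d : ℕ → Ω → Vec n) (T : ℕ) (p : ℝ) : Prop where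
  prob_eq : ∀ t < T, μ.real (attackEvent d t) = p
  indep_past : ∀ t < T,
    Indep (pastSigma A f d t) (MeasurableSpace.generateFrom {attackEvent d t}) μ

/-- Stealthy condition: given the past and the event of an attack at time `t`, the direction of the
attack has mean zero. -/
def Stealthy (μ : Measure Ω) (A : Matrix (Fin n) (Fin m) ℝ) (f : Vec n → Vec m)
    (d : ℕ → Ω → Vec n) (T : ℕ) : Prop :=
  ∀ t < T, (μ[|attackEvent d t])[attackDirection d t | pastSigma A f d t]
    =ᵐ[μ[|attackEvent d t]] 0

/-- The (regular) conditional law of the attack `d_t` given the past `(x_0, …, x_t)` and the event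
of an attack at time `t`, as a kernel in the values of the past. -/
noncomputable def attackLaw (μ : Measure Ω) [IsFiniteMeasure μ] (A : Matrix (Fin n) (Fin m) ℝ)
    (f : Vec n → Vec m) (d : ℕ → Ω → Vec n) (t : ℕ) : Kernel (Fin (t + 1) → Vec n) (Vec n) :=
  condDistrib (d t) (history A f d t) (μ[|attackEvent d t])

/-- The matrix `E[f(x + D) f(x + D)ᵀ]` for `D` of law `ν`. -/
noncomputable def secondMoment (f : Vec n → Vec m) (ν : Measure (Vec n)) (x : Vec n) :
    Matrix (Fin m) (Fin m) ℝ :=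
  Matrix.of fun i j => ∫ y, f (x + y) i * f (x + y) j ∂ν

/-- Non-degenerate condition: given the past and the event of an attack at time `t`, almost surely,
for every `x`, all eigenvalues of the conditional expectation of `f(x + d_t) f(x + d_t)ᵀ` are at
least `lam ^ 2`. -/
def Nondegenerate (μ : Measure Ω) [IsFiniteMeasure μ] (A : Matrix (Fin n) (Fin m) ℝ)
    (f : Vec n → Vec m) (d : ℕ → Ω → Vec n) (T : ℕ) (lam : ℝ) : Prop :=
  ∀ t < T, ∀ᵐ ω ∂(μ[|attackEvent d t]), ∀ x : Vec n,
    ∀ r ∈ spectrum ℝ (secondMoment f (attackLaw μ A f d t (history A f d t ω)) x), lam ^ 2 ≤ r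

end Model

/-! Moving from the true matrix `A` in a direction `D` changes the loss by at least the sum of
`normSlope (d t) (D f(x_t))`, so it suffices that this sum, `slopeSum`, is positive on the whole
unit sphere of directions (`isUniqueGlobalMin_loss`). A time without attack contributes `‖D f(x_t)‖
≥ 0`; an attacked time contributes a term of conditional mean zero, by stealthiness.

For a fixed `D`, the gain has a delay. An attack at time `t` makes `‖D f(x_{t+1})‖` large in second
moment, by non-degeneracy, but this pays off only if time `t + 1` is free of attack, which has
probability `1 - p`. The delay is absorbed by a credit: with `S_t` the slope sum, the expectation of
`exp(-θ S_t - (1-p)θ/2 ‖D f(x_t)‖)` shrinks by the factor `exp(-pη)` at each step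
(`integral_mul_exp_normSlope_le`, iterated in `integral_exp_slopeSum_le`). A Chernoff bound then
gives `S_T` of order `T` with exponentially small failure probability (`measureReal_slopeSum_le`).

To treat all `D` at once, `S_T` is Lipschitz in `D` with constant `T M`, where `‖f‖ ≤ M = √m B`. A
union bound over a net of the sphere in dimension `n m` concludes, and `pow_mul_exp_le_of_horizon`
turns the failure bound into the sample complexity. -/

section ExactRecovery

-- The Frobenius norm splits over rows, so the spectral bound on the second moment yields `E ‖D f‖²
-- ≥ lam² ‖D‖²` row by row; it also dominates the operator norm.
attribute [local instance] Matrix.frobeniusNormedAddCommGroup Matrix.frobeniusNormedSpace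

/-! ### Nets of the unit sphere by volume comparison. -/

section Covering

variable {E : Type*} [NormedAddCommGroup E] [NormedSpace ℝ E] [FiniteDimensional ℝ E]

/-- The cardinality of an `ε`-separated subset of the unit ball is at most `(3 / ε) ^ dim`. -/
lemma card_le_of_separated_of_norm_le_one {ε : ℝ} (hε : 0 < ε) (hε1 : ε ≤ 1) (s : Finset E)
    (hs : ∀ c ∈ s, ‖c‖ ≤ 1) (h : ∀ c ∈ s, ∀ d ∈ s, c ≠ d → ε ≤ ‖c - d‖) :
    (s.card : ℝ) ≤ (3 / ε) ^ Module.finrank ℝ E := by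
  borelize E
  let μ : Measure E := Measure.addHaar
  have hδ : 0 < ε / 2 := by positivity
  -- Since `1 + ε / 2 ≤ 3 / 2`, the ball of this radius contains all the disjoint balls of radius `ε
  -- / 2`.
  have hρ : (0 : ℝ) < 3 / 2 := by norm_num
  have hdisj : Set.Pairwise (s : Set E)
      (Function.onFun Disjoint fun c => Metric.ball (c : E) (ε / 2)) := by
    rintro c hc d hd hcd
    apply Metric.ball_disjoint_ball
    rw [dist_eq_norm, add_halves]
    exact h c hc d hd hcd
  have hsub : (⋃ c ∈ s, Metric.ball (c : E) (ε / 2)) ⊆ Metric.ball (0 : E) (3 / 2) := by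
    refine Set.iUnion₂_subset fun x hx => Metric.ball_subset_ball' ?_
    rw [dist_zero_right]
    linarith [hs x hx]
  have hvol : (s.card : ENNReal) * ENNReal.ofReal ((ε / 2) ^ Module.finrank ℝ E)
        * μ (Metric.ball 0 1)
      ≤ ENNReal.ofReal ((3 / 2) ^ Module.finrank ℝ E) * μ (Metric.ball 0 1) :=
    calc
      _ = μ (⋃ c ∈ s, Metric.ball (c : E) (ε / 2)) := by
        rw [measure_biUnion_finset hdisj fun c _ => measurableSet_ball]
        simp only [μ.addHaar_ball_of_pos _ hδ, Finset.sum_const, nsmul_eq_mul, mul_assoc]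
      _ ≤ μ (Metric.ball (0 : E) (3 / 2)) := measure_mono hsub
      _ = _ := by rw [μ.addHaar_ball_of_pos _ hρ]
  have hcard := (ENNReal.mul_le_mul_iff_left
    (Metric.measure_ball_pos _ _ zero_lt_one).ne' measure_ball_lt_top.ne).1 hvol
  have hreal := ENNReal.toReal_le_of_le_ofReal (pow_nonneg hρ.le _) hcard
  rw [ENNReal.toReal_mul, ENNReal.toReal_natCast, ENNReal.toReal_ofReal (by positivity)] at hreal
  have : (3 / ε) ^ Module.finrank ℝ E
      = (3 / 2) ^ Module.finrank ℝ E / (ε / 2) ^ Module.finrank ℝ E := by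
    rw [← div_pow]; congr 1; field_simp
  rw [this, le_div_iff₀ (by positivity)]
  exact hreal

/-- The unit sphere has an `ε`-net with at most `(3 / ε) ^ dim` points. -/
lemma exists_finset_net_sphere (E : Type*) [NormedAddCommGroup E] [NormedSpace ℝ E]
    [FiniteDimensional ℝ E] {ε : ℝ} (hε : 0 < ε) (hε1 : ε ≤ 1) :
    ∃ s : Finset E, (∀ c ∈ s, ‖c‖ = 1) ∧ (∀ x : E, ‖x‖ = 1 → ∃ c ∈ s, ‖x - c‖ ≤ ε) ∧
      (s.card : ℝ) ≤ (3 / ε) ^ Module.finrank ℝ E := by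
  classical
  -- Sizes of separated subsets of the sphere are bounded by volume; one of largest size is a net,
  -- since an uncovered point could be added to it.
  let S : Set ℕ := {k | ∃ s : Finset E, (∀ c ∈ s, ‖c‖ = 1) ∧
    (∀ c ∈ s, ∀ d ∈ s, c ≠ d → ε ≤ ‖c - d‖) ∧ s.card = k}
  have hne : S.Nonempty := ⟨0, ∅, by simp⟩
  have hbdd : BddAbove S := by
    refine ⟨⌊(3 / ε) ^ Module.finrank ℝ E⌋₊, ?_⟩
    rintro _ ⟨s, hs, hsep, rfl⟩
    exact Nat.le_floor
      (card_le_of_separated_of_norm_le_one hε hε1 s (fun c hc => (hs c hc).le) hsep)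
  obtain ⟨s, hs, hsep, hcard⟩ := Nat.sSup_mem hne hbdd
  refine ⟨s, hs, fun x hx => ?_,
    card_le_of_separated_of_norm_le_one hε hε1 s (fun c hc => (hs c hc).le) hsep⟩
  by_contra! hfar
  have hxs : x ∉ s := fun hmem => by
    have := hfar x hmem
    simp only [sub_self, norm_zero] at this
    linarith
  have hmem : (insert x s).card ∈ S := by
    refine ⟨insert x s, ?_, ?_, rfl⟩
    · intro c hc
      rcases Finset.mem_insert.1 hc with rfl | hc
      exacts [hx, hs c hc]
    · intro c hc d hd hcd
      rcases Finset.mem_insert.1 hc with rfl | hc' <;> rcases Finset.mem_insert.1 hd with rfl | hd'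
      · exact absurd rfl hcd
      · exact (hfar d hd').le
      · rw [norm_sub_rev]; exact (hfar c hc').le
      · exact hsep c hc' d hd' hcd
  have := le_csSup hbdd hmem
  rw [Finset.card_insert_of_notMem hxs] at this
  omega

end Covering

/-! ### Norm bounds for matrix-vector products. -/

section MatVec

variable {n m : ℕ}

lemma matVec_sub_left (A A' : Matrix (Fin n) (Fin m) ℝ) (v : Vec m) :
    matVec (A - A') v = matVec A v - matVec A' v := by
  ext i; simp [matVec, Matrix.sub_mulVec]

lemma matVec_smul_left (c : ℝ) (A : Matrix (Fin n) (Fin m) ℝ) (v : Vec m) :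
    matVec (c • A) v = c • matVec A v := by
  ext i; simp [matVec, Matrix.smul_mulVec]

lemma norm_matVec_le (A : Matrix (Fin n) (Fin m) ℝ) (v : Vec m) :
    ‖matVec A v‖ ≤ ‖A‖ * ‖v‖ := by
  have h := Matrix.frobenius_norm_mul A (Matrix.replicateCol Unit v.ofLp)
  rw [← Matrix.replicateCol_mulVec, Matrix.frobenius_norm_replicateCol,
    Matrix.frobenius_norm_replicateCol] at h
  exact h

lemma continuous_matVec (A : Matrix (Fin n) (Fin m) ℝ) : Continuous (matVec A) := by
  unfold matVec
  refine (PiLp.continuous_toLp 2 _).comp ?_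
  exact Continuous.matrix_mulVec continuous_const (PiLp.continuous_ofLp 2 _)

lemma frobenius_norm_sq (A : Matrix (Fin n) (Fin m) ℝ) : ‖A‖ ^ 2 = ∑ i, ∑ j, A i j ^ 2 := by
  rw [Matrix.frobenius_norm_def, ← Real.sqrt_eq_rpow, Real.sq_sqrt (by positivity)]
  simp

lemma norm_le_of_boundedBasis {f : Vec n → Vec m} {B : ℝ} (hB : 0 ≤ B) (h : BoundedBasis f B)
    (x : Vec n) : ‖f x‖ ≤ √m * B := by
  rw [EuclideanSpace.norm_eq]
  have : ∑ i, ‖f x i‖ ^ 2 ≤ m * B ^ 2 := by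
    calc ∑ i, ‖f x i‖ ^ 2 ≤ ∑ _i : Fin m, B ^ 2 :=
          Finset.sum_le_sum fun i _ => pow_le_pow_left₀ (norm_nonneg _) (h x i) 2
      _ = m * B ^ 2 := by simp
  calc √(∑ i, ‖f x i‖ ^ 2) ≤ √(m * B ^ 2) := Real.sqrt_le_sqrt this
    _ = √m * B := by rw [Real.sqrt_mul (by positivity), Real.sqrt_sq hB]

end MatVec

/-! ### Slope of the loss at the true matrix. -/

section Slope

variable {n m : ℕ}

/-- A lower bound for the slope at `w = 0` of `w ↦ ‖d - w‖` in the direction `w`. -/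
noncomputable def normSlope (d w : Vec n) : ℝ :=
  if d = 0 then ‖w‖ else -inner ℝ (‖d‖⁻¹ • d) w

lemma norm_inv_norm_smul_le (d : Vec n) : ‖‖d‖⁻¹ • d‖ ≤ 1 := by
  rw [norm_smul, norm_inv, norm_norm]
  exact inv_mul_le_one

/-- Subgradient inequality: for `d ≠ 0`, pair `d - w` with the vector `d / ‖d‖` and use
Cauchy–Schwarz; for `d = 0` it is an equality. -/
lemma norm_add_normSlope_le (d w : Vec n) : ‖d‖ + normSlope d w ≤ ‖d - w‖ := by
  unfold normSlope
  split_ifs with h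
  · simp [h]
  · have hd : ‖d‖ ≠ 0 := norm_ne_zero_iff.2 h
    have h1 : inner ℝ (‖d‖⁻¹ • d) (d - w) ≤ ‖d - w‖ := by
      calc _ ≤ ‖‖d‖⁻¹ • d‖ * ‖d - w‖ := real_inner_le_norm _ _
        _ ≤ 1 * ‖d - w‖ := by gcongr; exact norm_inv_norm_smul_le d
        _ = _ := one_mul _
    rw [inner_sub_right] at h1
    have h2 : inner ℝ (‖d‖⁻¹ • d) d = ‖d‖ := by
      rw [real_inner_smul_left, real_inner_self_eq_norm_sq]; field_simp
    linarith

lemma normSlope_sub_le (d w w' : Vec n) : normSlope d w - normSlope d w' ≤ ‖w - w'‖ := by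
  unfold normSlope
  split_ifs with h
  · exact norm_sub_norm_le _ _
  · calc _ = inner ℝ (‖d‖⁻¹ • d) (w' - w) := by rw [inner_sub_right]; ring
      _ ≤ ‖‖d‖⁻¹ • d‖ * ‖w' - w‖ := real_inner_le_norm _ _
      _ ≤ 1 * ‖w' - w‖ := by gcongr; exact norm_inv_norm_smul_le d
      _ = _ := by rw [one_mul, norm_sub_rev]

lemma abs_normSlope_le (d w : Vec n) : |normSlope d w| ≤ ‖w‖ := by
  have h0 : normSlope d 0 = 0 := by simp [normSlope]
  rw [abs_le]
  constructor
  · have := normSlope_sub_le d 0 w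
    rw [h0, zero_sub, zero_sub, norm_neg] at this
    linarith
  · have := normSlope_sub_le d w 0
    rw [h0, sub_zero, sub_zero] at this
    exact this

lemma normSlope_smul (d w : Vec n) {c : ℝ} (hc : 0 ≤ c) :
    normSlope d (c • w) = c * normSlope d w := by
  unfold normSlope
  split_ifs with h
  · rw [norm_smul, Real.norm_of_nonneg hc]
  · rw [real_inner_smul_right]; ring

lemma measurable_normSlope : Measurable fun z : Vec n × Vec n => normSlope z.1 z.2 := by
  unfold normSlope
  refine Measurable.ite (measurable_fst (measurableSet_singleton 0)) (by fun_prop) ?_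
  refine Measurable.neg (Measurable.inner ?_ measurable_snd)
  exact (measurable_fst.norm.inv).smul measurable_fst

/-- If the loss has positive slope at `A` in all directions of the unit sphere, then `A` is its
unique global minimizer. -/
lemma isUniqueGlobalMin_loss (A : Matrix (Fin n) (Fin m) ℝ) (f : Vec n → Vec m) (d : ℕ → Vec n)
    (T : ℕ) (h : ∀ D : Matrix (Fin n) (Fin m) ℝ, ‖D‖ = 1 →
      0 < ∑ t ∈ Finset.range T, normSlope (d t) (matVec D (f (trajectory A f d t)))) :
    IsUniqueGlobalMin (loss f (trajectory A f d) T) A := by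
  have hlt : ∀ A', A' ≠ A → loss f (trajectory A f d) T A < loss f (trajectory A f d) T A' := by
    intro A' hA'
    have hne : ‖A' - A‖ ≠ 0 := norm_ne_zero_iff.2 (sub_ne_zero.2 hA')
    have hpos : 0 < ‖A' - A‖ := lt_of_le_of_ne (norm_nonneg _) hne.symm
    have hunit : ‖‖A' - A‖⁻¹ • (A' - A)‖ = 1 := by
      rw [norm_smul, norm_inv, norm_norm, inv_mul_cancel₀ hne]
    have key := h _ hunit
    simp only [matVec_smul_left, normSlope_smul _ _ (inv_nonneg.2 hpos.le),
      ← Finset.mul_sum] at key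
    have key' := (pos_iff_pos_of_mul_pos key).1 (inv_pos.2 hpos)
    have hle : loss f (trajectory A f d) T A
        + ∑ t ∈ Finset.range T, normSlope (d t) (matVec (A' - A) (f (trajectory A f d t)))
        ≤ loss f (trajectory A f d) T A' := by
      unfold loss
      rw [← Finset.sum_add_distrib]
      refine Finset.sum_le_sum fun t _ => ?_
      have h1 : trajectory A f d (t + 1) - matVec A (f (trajectory A f d t)) = d t := by
        simp [trajectory]
      have h2 : trajectory A f d (t + 1) - matVec A' (f (trajectory A f d t))
          = d t - matVec (A' - A) (f (trajectory A f d t)) := by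
        rw [matVec_sub_left]; simp only [trajectory]; abel
      rw [h1, h2]
      exact norm_add_normSlope_le _ _
    linarith
  ext A'
  simp only [Set.mem_ofPred_eq, Set.mem_singleton_iff]
  constructor
  · intro hA'
    by_contra hne
    exact absurd (hA' A) (not_le.2 (hlt A' hne))
  · rintro rfl c
    rcases eq_or_ne c A' with rfl | hc
    exacts [le_rfl, (hlt c hc).le]

end Slope

/-! ### Consequences of the spectral lower bound on the second moment. -/

section SecondMoment

variable {n m : ℕ}

lemma Matrix.IsHermitian.mul_dotProduct_le_of_le_spectrum {ι : Type*} [Fintype ι] [DecidableEq ι]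
    {S : Matrix ι ι ℝ} (hS : S.IsHermitian) {c : ℝ} (h : ∀ r ∈ spectrum ℝ S, c ≤ r)
    (v : ι → ℝ) : c * (v ⬝ᵥ v) ≤ v ⬝ᵥ S.mulVec v := by
  have hpsd : (S - algebraMap ℝ (Matrix ι ι ℝ) c).PosSemidef := by
    rw [Matrix.posSemidef_iff_isHermitian_and_spectrum_nonneg]
    refine ⟨hS.sub ?_, fun r hr => ?_⟩
    · rw [Algebra.algebraMap_eq_smul_one]
      simp [Matrix.IsHermitian]
    · have : r + c ∈ spectrum ℝ S := by
        rw [spectrum.add_mem_iff, neg_add_eq_sub]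
        exact hr
      have := h _ this
      simpa using this
  have := hpsd.dotProduct_mulVec_nonneg v
  rw [Matrix.sub_mulVec, dotProduct_sub, Algebra.algebraMap_eq_smul_one, Matrix.smul_mulVec,
    Matrix.one_mulVec, dotProduct_smul] at this
  simpa using this

lemma isHermitian_secondMoment (f : Vec n → Vec m) (ν : Measure (Vec n)) (x : Vec n) :
    (secondMoment f ν x).IsHermitian := by
  ext i j
  simp [secondMoment, mul_comm]

lemma integrable_mul_of_boundedBasis {f : Vec n → Vec m} (hf : Measurable f) {B : ℝ}
    (h : BoundedBasis f B) (ν : Measure (Vec n)) [IsProbabilityMeasure ν] (x : Vec n)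
    (i j : Fin m) : Integrable (fun y => f (x + y) i * f (x + y) j) ν := by
  refine Integrable.of_bound (C := B * B) ?_ (Filter.Eventually.of_forall fun y => ?_)
  · refine Measurable.aestronglyMeasurable ?_
    have := hf.comp (measurable_const_add x)
    exact (by fun_prop : Measurable fun y => (f ∘ (x + ·)) y i * (f ∘ (x + ·)) y j)
  · rw [norm_mul]
    exact mul_le_mul (h _ i) (h _ j) (norm_nonneg _) ((abs_nonneg _).trans (h (x + y) i))

lemma dotProduct_secondMoment {f : Vec n → Vec m} (hf : Measurable f) {B : ℝ}
    (h : BoundedBasis f B) (ν : Measure (Vec n)) [IsProbabilityMeasure ν] (x : Vec n)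
    (v : Fin m → ℝ) :
    v ⬝ᵥ (secondMoment f ν x).mulVec v = ∫ y, (v ⬝ᵥ (f (x + y)).ofLp) ^ 2 ∂ν := by
  have hint := integrable_mul_of_boundedBasis hf h ν x
  have : ∀ y, (v ⬝ᵥ (f (x + y)).ofLp) ^ 2
      = ∑ i, ∑ j, v i * v j * (f (x + y) i * f (x + y) j) := by
    intro y
    simp only [dotProduct, sq, Finset.sum_mul_sum]
    exact Finset.sum_congr rfl fun i _ => Finset.sum_congr rfl fun j _ => by ring
  simp only [this]
  rw [integral_finsetSum _ fun i _ => integrable_finsetSum _ fun j _ => (hint i j).const_mul _]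
  simp only [dotProduct, Matrix.mulVec, Finset.mul_sum]
  refine Finset.sum_congr rfl fun i _ => ?_
  rw [integral_finsetSum _ fun j _ => (hint i j).const_mul _]
  refine Finset.sum_congr rfl fun j _ => ?_
  rw [integral_const_mul]
  simp only [secondMoment, Matrix.of_apply]
  ring

/-- A spectral lower bound on the second moment of `f` bounds `E ‖D f‖²` from below. -/
lemma mul_norm_sq_le_integral_matVec {f : Vec n → Vec m} (hf : Measurable f) {B : ℝ}
    (h : BoundedBasis f B) (ν : Measure (Vec n)) [IsProbabilityMeasure ν] (x : Vec n) {c : ℝ}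
    (hc : ∀ r ∈ spectrum ℝ (secondMoment f ν x), c ≤ r) (D : Matrix (Fin n) (Fin m) ℝ) :
    c * ‖D‖ ^ 2 ≤ ∫ y, ‖matVec D (f (x + y))‖ ^ 2 ∂ν := by
  have hrow : ∀ y, ‖matVec D (f (x + y))‖ ^ 2 = ∑ i, (D i ⬝ᵥ (f (x + y)).ofLp) ^ 2 := by
    intro y
    rw [EuclideanSpace.norm_sq_eq]
    simp [matVec, Matrix.mulVec]
  have hint : ∀ i, Integrable (fun y => (D i ⬝ᵥ (f (x + y)).ofLp) ^ 2) ν := by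
    intro i
    have : ∀ y, (D i ⬝ᵥ (f (x + y)).ofLp) ^ 2
        = ∑ j, ∑ k, D i j * D i k * (f (x + y) j * f (x + y) k) := by
      intro y
      simp only [dotProduct, sq, Finset.sum_mul_sum]
      exact Finset.sum_congr rfl fun i _ => Finset.sum_congr rfl fun j _ => by ring
    simp only [this]
    exact integrable_finsetSum _ fun j _ => integrable_finsetSum _ fun k _ =>
      (integrable_mul_of_boundedBasis hf h ν x j k).const_mul _
  simp only [hrow]
  rw [integral_finsetSum _ fun i _ => hint i, frobenius_norm_sq, Finset.mul_sum]
  refine Finset.sum_le_sum fun i _ => ?_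
  rw [← dotProduct_secondMoment hf h ν x (D i)]
  have := (isHermitian_secondMoment f ν x).mul_dotProduct_le_of_le_spectrum hc (D i)
  simpa [dotProduct, sq] using this

/-- Testing the quadratic form on a basis vector gives a diagonal entry `E[f_i²] ≤ B²`. This is the
source of `κ ≥ 1`. -/
lemma le_sq_of_le_spectrum_secondMoment {f : Vec n → Vec m} (hf : Measurable f) {B : ℝ}
    (h : BoundedBasis f B) (ν : Measure (Vec n)) [IsProbabilityMeasure ν] (x : Vec n) {c : ℝ}
    (hc : ∀ r ∈ spectrum ℝ (secondMoment f ν x), c ≤ r) (i : Fin m) : c ≤ B ^ 2 := by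
  have h1 := (isHermitian_secondMoment f ν x).mul_dotProduct_le_of_le_spectrum hc (Pi.single i 1)
  rw [dotProduct_secondMoment hf h ν x] at h1
  simp only [single_dotProduct, Pi.single_eq_same, one_mul, mul_one] at h1
  refine h1.trans ?_
  calc ∫ y, (f (x + y) i) ^ 2 ∂ν ≤ ∫ _y, B ^ 2 ∂ν := by
        refine integral_mono_of_nonneg (Filter.Eventually.of_forall fun y => sq_nonneg _)
          (integrable_const _) (Filter.Eventually.of_forall fun y => ?_)
        exact sq_le_sq' (abs_le.1 (h (x + y) i)).1 (abs_le.1 (h (x + y) i)).2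
    _ = B ^ 2 := by simp

end SecondMoment

/-! ### One step of the exponential supermartingale. -/

section OneStep

variable {Ω : Type*} {F mΩ : MeasurableSpace Ω} {μ : Measure Ω}

lemma setIntegral_eq_measureReal_mul_integral_cond {E : Set Ω} (hE : μ.real E ≠ 0) (h : Ω → ℝ) :
    ∫ ω in E, h ω ∂μ = μ.real E * ∫ ω, h ω ∂(μ[|E]) := by
  rw [ProbabilityTheory.cond, integral_smul_measure, ENNReal.toReal_inv, smul_eq_mul,
    ← Measure.real, mul_inv_cancel_left₀ hE]

lemma setIntegral_eq_measureReal_mul_integral_of_indep [IsProbabilityMeasure μ] (hF : F ≤ mΩ) {E : Set Ω}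
    (hE : MeasurableSet E) (hind : Indep F (MeasurableSpace.generateFrom {E}) μ) {h : Ω → ℝ}
    (hh : StronglyMeasurable[F] h) :
    ∫ ω in E, h ω ∂μ = μ.real E * ∫ ω, h ω ∂μ := by
  have hEind : Measurable[MeasurableSpace.generateFrom {E}] (E.indicator fun _ => (1 : ℝ)) :=
    measurable_const.indicator (MeasurableSpace.measurableSet_generateFrom (Set.mem_singleton E))
  have hfun : IndepFun h (E.indicator fun _ => (1 : ℝ)) μ :=
    (IndepFun_iff_Indep _ _ _).2 (indep_of_indep_of_le_left
      (indep_of_indep_of_le_right hind hEind.comap_le) hh.measurable.comap_le)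
  have hmul := hfun.integral_fun_mul_eq_mul_integral (hh.mono hF).aestronglyMeasurable
    (measurable_const.indicator hE).aestronglyMeasurable
  rw [integral_indicator hE] at hmul
  simp only [integral_const, smul_eq_mul, mul_one, measureReal_restrict_apply_univ] at hmul
  rw [mul_comm, ← hmul, ← integral_indicator hE]
  refine integral_congr_ae (Filter.Eventually.of_forall fun ω => ?_)
  by_cases hω : ω ∈ E <;> simp [hω]

/-- A past-measurable vector is uncorrelated with a vector of conditional mean zero. -/
lemma integral_inner_eq_zero_of_condExp_eq_zero {ν : Measure Ω} [IsProbabilityMeasure ν]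
    (hF : F ≤ mΩ) {n : ℕ} {v u : Ω → Vec n} (hv : StronglyMeasurable[F] v) (hu : Measurable u)
    {K L : ℝ} (hvK : ∀ ω, ‖v ω‖ ≤ K) (huL : ∀ ω, ‖u ω‖ ≤ L) (h0 : ν[u | F] =ᵐ[ν] 0) :
    ∫ ω, inner ℝ (v ω) (u ω) ∂ν = 0 := by
  have huint : Integrable u ν :=
    Integrable.of_bound hu.aestronglyMeasurable L (Filter.Eventually.of_forall huL)
  have hint : Integrable (fun ω => innerSL ℝ (v ω) (u ω)) ν := by
    refine Integrable.of_bound (C := K * L) ?_ (Filter.Eventually.of_forall fun ω => ?_)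
    · exact ((hv.mono hF).inner hu.stronglyMeasurable).aestronglyMeasurable
    · exact (norm_inner_le_norm _ _).trans
        (mul_le_mul (hvK ω) (huL ω) (norm_nonneg _) ((norm_nonneg _).trans (hvK ω)))
  have hpull := condExp_bilin_of_stronglyMeasurable_left (innerSL ℝ) hv hint huint
  calc ∫ ω, inner ℝ (v ω) (u ω) ∂ν = ∫ ω, (ν[fun ω => innerSL ℝ (v ω) (u ω) | F]) ω ∂ν :=
        (integral_condExp hF).symm
    _ = ∫ _ω, (0 : ℝ) ∂ν := by
        refine integral_congr_ae ?_
        filter_upwards [hpull, h0] with ω h1 h2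
        rw [h1, h2]; simp
    _ = 0 := by simp

lemma mul_integral_le_integral_mul_of_le_condExp {ν : Measure Ω} [IsProbabilityMeasure ν]
    (hF : F ≤ mΩ) {G h : Ω → ℝ} (hG : StronglyMeasurable[F] G) (hh : Measurable h) {K L q : ℝ}
    (hG0 : ∀ ω, 0 ≤ G ω) (hGK : ∀ ω, G ω ≤ K) (hhL : ∀ ω, |h ω| ≤ L)
    (hq : ∀ᵐ ω ∂ν, q ≤ (ν[h | F]) ω) :
    q * ∫ ω, G ω ∂ν ≤ ∫ ω, G ω * h ω ∂ν := by
  have hGb : ∀ ω, ‖G ω‖ ≤ K := fun ω => by rw [Real.norm_of_nonneg (hG0 ω)]; exact hGK ω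
  have hGint : Integrable G ν := Integrable.of_bound (hG.mono hF).aestronglyMeasurable K
    (Filter.Eventually.of_forall hGb)
  have hhint : Integrable h ν :=
    Integrable.of_bound hh.aestronglyMeasurable L (Filter.Eventually.of_forall hhL)
  have hint : Integrable (G * h) ν := hhint.bdd_mul hGint.1 (Filter.Eventually.of_forall hGb)
  have hpull := condExp_mul_of_stronglyMeasurable_left hG hint hhint
  rw [← integral_const_mul]
  calc ∫ ω, q * G ω ∂ν ≤ ∫ ω, (ν[G * h | F]) ω ∂ν := by
        refine integral_mono_ae (hGint.const_mul q) integrable_condExp ?_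
        filter_upwards [hpull, hq] with ω h1 h2
        rw [h1, Pi.mul_apply, mul_comm]
        exact mul_le_mul_of_nonneg_left h2 (hG0 ω)
    _ = ∫ ω, G ω * h ω ∂ν := integral_condExp hF

/-- Here `exp(-x) ≤ 1 - x + x²` and `x² ≤ x / 2`. The lost half explains the weight `(1 - p) θ / 2`
of the credit. -/
lemma exp_neg_le_one_sub_half {x : ℝ} (h0 : 0 ≤ x) (h1 : x ≤ 1 / 2) :
    Real.exp (-x) ≤ 1 - x / 2 := by
  have := (abs_le.1 (Real.abs_exp_sub_one_sub_id_le (x := -x) (by rw [abs_neg, abs_of_nonneg h0]; linarith))).2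
  nlinarith

/-- One step of the exponential supermartingale: the attack vector `d` occurs with probability `p`
independently of the past `F` and has a centered direction, `w` is a past-measurable vector, and the
next norm `b` has conditional second moment at least `q` given an attack. -/
lemma integral_mul_exp_normSlope_le [IsProbabilityMeasure μ] (hF : F ≤ mΩ) {n : ℕ} {d w : Ω → Vec n} {G b : Ω → ℝ}
    {p M q K : ℝ} (hp0 : 0 < p) (hp1 : p < 1) (hM : 0 < M) (hq0 : 0 < q) (hqM : q ≤ M ^ 2)
    (hd : Measurable d) (hw : StronglyMeasurable[F] w) (hG : StronglyMeasurable[F] G)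
    (hb : Measurable b) (hG0 : ∀ ω, 0 ≤ G ω) (hGK : ∀ ω, G ω ≤ K) (hwM : ∀ ω, ‖w ω‖ ≤ M)
    (hb0 : ∀ ω, 0 ≤ b ω) (hbM : ∀ ω, b ω ≤ M) (hp : μ.real {ω | d ω ≠ 0} = p)
    (hind : Indep F (MeasurableSpace.generateFrom {{ω | d ω ≠ 0}}) μ)
    (hst : (μ[|{ω | d ω ≠ 0}])[fun ω => ‖d ω‖⁻¹ • d ω | F] =ᵐ[μ[|{ω | d ω ≠ 0}]] 0)
    (hnd : ∀ᵐ ω ∂(μ[|{ω | d ω ≠ 0}]), q ≤ ((μ[|{ω | d ω ≠ 0}])[fun ω => b ω ^ 2 | F]) ω)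
    {θ η : ℝ} (hθ : θ = (1 - p) * q / (12 * M ^ 3)) (hη : η = (1 - p) * θ * q / (4 * M)) :
    ∫ ω, G ω * Real.exp (-θ * normSlope (d ω) (w ω) - (1 - p) * θ / 2 * b ω) ∂μ ≤
      Real.exp (-(p * η)) * ∫ ω, G ω * Real.exp (-((1 - p) * θ / 2 * ‖w ω‖)) ∂μ := by
  set E : Set Ω := {ω | d ω ≠ 0} with hEdef
  have hE : MeasurableSet E := (hd (measurableSet_singleton 0)).compl
  have hp1' : 0 < 1 - p := by linarith
  have hθ0 : 0 < θ := by rw [hθ]; positivity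
  have hθM : θ * M ≤ 1 / 12 := by
    have : θ * M = (1 - p) * (q / M ^ 2) / 12 := by rw [hθ]; field_simp
    rw [this]
    have h1 : q / M ^ 2 ≤ 1 := by rw [div_le_one (by positivity)]; exact hqM
    have h2 : 0 < q / M ^ 2 := by positivity
    nlinarith
  -- The value of `θ` balances first and second order: `η` dominates the quadratic error of the
  -- exponential while being only half of the expected gain of an attack.
  have hη3 : η = 3 * (θ * M) ^ 2 := by rw [hη, hθ]; field_simp; ring
  have hEne : μ.real E ≠ 0 := by rw [hp]; exact hp0.ne'
  have : IsProbabilityMeasure (μ[|E]) :=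
    cond_isProbabilityMeasure (fun h => hEne (by simp [Measure.real, h]))
  have hK : ∀ ω, ‖G ω‖ ≤ K := fun ω => by rw [Real.norm_of_nonneg (hG0 ω)]; exact hGK ω
  have hGm := (hG.mono hF)
  have hwm := (hw.mono hF)
  set u : Ω → Vec n := fun ω => ‖d ω‖⁻¹ • d ω with hu
  have hum : Measurable u := (hd.norm.inv).smul hd
  have hu1 : ∀ ω, ‖u ω‖ ≤ 1 := fun ω => norm_inv_norm_smul_le _
  have hsm : Measurable fun ω => normSlope (d ω) (w ω) :=
    measurable_normSlope.comp (hd.prodMk hwm.measurable)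
  have hinner : ∀ ω, |inner ℝ (u ω) (w ω)| ≤ M := fun ω =>
    (abs_real_inner_le_norm _ _).trans
      ((mul_le_mul (hu1 ω) (hwM ω) (norm_nonneg _) zero_le_one).trans (one_mul M).le)
  -- integrability
  have hGi : ∀ {ν : Measure Ω} [IsFiniteMeasure ν], Integrable G ν := fun {ν} _ =>
    Integrable.of_bound hGm.aestronglyMeasurable K (Filter.Eventually.of_forall hK)
  have hGmul : ∀ {ν : Measure Ω} [IsFiniteMeasure ν] {g : Ω → ℝ} (L : ℝ), Measurable g →
      (∀ ω, |g ω| ≤ L) → Integrable (fun ω => G ω * g ω) ν := fun {ν} _ g L hg hgL =>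
    (Integrable.of_bound hg.aestronglyMeasurable L (Filter.Eventually.of_forall hgL)).bdd_mul
      hGm.aestronglyMeasurable (Filter.Eventually.of_forall hK)
  have hxb : ∀ ω, -θ * normSlope (d ω) (w ω) - (1 - p) * θ / 2 * b ω ≤ 1 := by
    intro ω
    have h1 := (abs_le.1 ((abs_normSlope_le (d ω) (w ω)).trans (hwM ω))).1
    have h2 : 0 ≤ (1 - p) * θ / 2 * b ω := mul_nonneg (by positivity) (hb0 ω)
    nlinarith
  have hint_lhs : Integrable (fun ω =>
      G ω * Real.exp (-θ * normSlope (d ω) (w ω) - (1 - p) * θ / 2 * b ω)) μ := by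
    refine hGmul (Real.exp 1) (by fun_prop) fun ω => ?_
    rw [Real.abs_exp]
    exact Real.exp_le_exp.2 (hxb ω)
  have hwexp : ∀ {c : ℝ}, 0 ≤ c → ∀ ω, |Real.exp (-(c * ‖w ω‖))| ≤ 1 := fun hc ω => by
    rw [Real.abs_exp, Real.exp_le_one_iff, neg_nonpos]
    positivity
  have hwn : Measurable fun ω => ‖w ω‖ := hwm.measurable.norm
  have hint_e : Integrable (fun ω => G ω * Real.exp (-(θ * ‖w ω‖))) μ :=
    hGmul 1 (by fun_prop) (hwexp hθ0.le)
  -- no attack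
  have hcompl : ∫ ω in Eᶜ, G ω * Real.exp (-θ * normSlope (d ω) (w ω)
      - (1 - p) * θ / 2 * b ω) ∂μ ≤ (1 - p) * ∫ ω, G ω * Real.exp (-(θ * ‖w ω‖)) ∂μ := by
    calc _ ≤ ∫ ω in Eᶜ, G ω * Real.exp (-(θ * ‖w ω‖)) ∂μ := by
          refine setIntegral_mono_on hint_lhs.integrableOn hint_e.integrableOn hE.compl
            fun ω hω => mul_le_mul_of_nonneg_left (Real.exp_le_exp.2 ?_) (hG0 ω)
          have hdω : d ω = 0 := by simpa [hEdef] using hω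
          -- Without attack nothing is known about the next norm `b`, so its credit is dropped.
          have h2 : 0 ≤ (1 - p) * θ / 2 * b ω := mul_nonneg (by positivity) (hb0 ω)
          rw [normSlope, if_pos hdω]
          linarith
      _ = _ := by
          have h1 := integral_add_compl hE hint_e
          rw [setIntegral_eq_measureReal_mul_integral_of_indep hF hE hind, hp] at h1
          · linarith
          · exact hG.mul (Real.continuous_exp.comp_stronglyMeasurable
              ((hw.norm.const_mul θ).neg))
  -- attack
  have hattack : ∫ ω in E, G ω * Real.exp (-θ * normSlope (d ω) (w ω)
      - (1 - p) * θ / 2 * b ω) ∂μ ≤ p * (1 - η) * ∫ ω, G ω ∂μ := by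
    have hbd : ∀ ω ∈ E, G ω * Real.exp (-θ * normSlope (d ω) (w ω) - (1 - p) * θ / 2 * b ω)
        ≤ (1 + η) * G ω + θ * (G ω * inner ℝ (u ω) (w ω))
          - (1 - p) * θ / (2 * M) * (G ω * b ω ^ 2) := by
      intro ω hω
      have hx : -θ * normSlope (d ω) (w ω) = θ * inner ℝ (u ω) (w ω) := by
        rw [normSlope, if_neg hω]; ring
      rw [hx]
      have hi := abs_le.1 (hinner ω)
      have hbω := hb0 ω
      have hbω' := hbM ω
      set x := θ * inner ℝ (u ω) (w ω) - (1 - p) * θ / 2 * b ω with hxdef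
      have hx1 : |x| ≤ 3 / 2 * (θ * M) := by
        have h1 : |θ * inner ℝ (u ω) (w ω)| ≤ θ * M := by
          rw [abs_mul, abs_of_pos hθ0]
          exact mul_le_mul_of_nonneg_left (hinner ω) hθ0.le
        have h2 : |(1 - p) * θ / 2 * b ω| ≤ 1 / 2 * (θ * M) := by
          rw [abs_of_nonneg (by positivity)]
          have : θ * b ω ≤ θ * M := by gcongr
          have h0 : 0 ≤ θ * b ω := by positivity
          nlinarith
        calc |x| ≤ |θ * inner ℝ (u ω) (w ω)| + |(1 - p) * θ / 2 * b ω| := abs_sub _ _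
          _ ≤ _ := by linarith
      -- `exp x ≤ 1 + x + x²`, with `x² ≤ (9/4)(θM)² ≤ η`.
      have hexp := (abs_le.1 (Real.abs_exp_sub_one_sub_id_le (x := x) (by linarith))).2
      have hx2 : x ^ 2 ≤ η := by
        have : x ^ 2 ≤ (3 / 2 * (θ * M)) ^ 2 := sq_le_sq' (abs_le.1 hx1).1 (abs_le.1 hx1).2
        rw [hη3]
        nlinarith [sq_nonneg (θ * M)]
      -- Only the second moment of `b` is controlled; `b ≤ M` gives `b ≥ b² / M`.
      have hb2 : (1 - p) * θ / (2 * M) * b ω ^ 2 ≤ (1 - p) * θ / 2 * b ω := by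
        have : (1 - p) * θ / (2 * M) * b ω ^ 2 = (1 - p) * θ / 2 * (b ω * (b ω / M)) := by
          field_simp
        rw [this]
        refine mul_le_mul_of_nonneg_left ?_ (by positivity)
        exact mul_le_of_le_one_right hbω ((div_le_one hM).2 hbω')
      calc G ω * Real.exp x ≤ G ω * (1 + η + θ * inner ℝ (u ω) (w ω)
            - (1 - p) * θ / (2 * M) * b ω ^ 2) :=
            mul_le_mul_of_nonneg_left (by linarith) (hG0 ω)
        _ = _ := by ring
    have hi1 : ∀ {ν : Measure Ω} [IsFiniteMeasure ν], Integrable (fun ω => (1 + η) * G ω) ν :=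
      hGi.const_mul _
    have hi2 : ∀ {ν : Measure Ω} [IsFiniteMeasure ν],
        Integrable (fun ω => θ * (G ω * inner ℝ (u ω) (w ω))) ν := fun {ν} _ =>
      (hGmul M (hum.inner hwm.measurable) hinner).const_mul _
    have hi3 : ∀ {ν : Measure Ω} [IsFiniteMeasure ν],
        Integrable (fun ω => (1 - p) * θ / (2 * M) * (G ω * b ω ^ 2)) ν := fun {ν} _ =>
      (hGmul (M ^ 2) (by fun_prop) fun ω => by
        rw [abs_of_nonneg (sq_nonneg _)]
        exact pow_le_pow_left₀ (hb0 ω) (hbM ω) 2).const_mul _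
    have hi12 : Integrable (fun ω => (1 + η) * G ω + θ * (G ω * inner ℝ (u ω) (w ω))) (μ[|E]) :=
      hi1.add hi2
    have hzero : ∫ ω, G ω * inner ℝ (u ω) (w ω) ∂(μ[|E]) = 0 := by
      have := integral_inner_eq_zero_of_condExp_eq_zero hF (v := fun ω => G ω • w ω)
        (hG.smul hw) hum (K := K * M) (L := 1) (fun ω => by
          rw [norm_smul]
          exact mul_le_mul (hK ω) (hwM ω) (norm_nonneg _) ((norm_nonneg _).trans (hK ω))) hu1 hst
      simpa only [real_inner_smul_left, real_inner_comm] using this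
    have hmean : ∫ ω, G ω ∂(μ[|E]) = ∫ ω, G ω ∂μ := by
      have h1 := setIntegral_eq_measureReal_mul_integral_of_indep hF hE hind hG
      rw [setIntegral_eq_measureReal_mul_integral_cond hEne] at h1
      exact mul_left_cancel₀ hEne h1
    have hsecond := mul_integral_le_integral_mul_of_le_condExp (ν := μ[|E]) hF hG
      (h := fun ω => b ω ^ 2) (by fun_prop) (L := M ^ 2) hG0 hGK (fun ω => by
        rw [abs_of_nonneg (sq_nonneg _)]
        exact pow_le_pow_left₀ (hb0 ω) (hbM ω) 2) hnd
    rw [hmean] at hsecond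
    calc _ ≤ ∫ ω in E, ((1 + η) * G ω + θ * (G ω * inner ℝ (u ω) (w ω))
          - (1 - p) * θ / (2 * M) * (G ω * b ω ^ 2)) ∂μ :=
          setIntegral_mono_on hint_lhs.integrableOn ((hi1.add hi2).sub hi3).integrableOn hE hbd
      _ = p * ((1 + η) * ∫ ω, G ω ∂μ
          - (1 - p) * θ / (2 * M) * ∫ ω, G ω * b ω ^ 2 ∂(μ[|E])) := by
          rw [setIntegral_eq_measureReal_mul_integral_cond hEne, hp,
            integral_sub hi12 hi3, integral_add hi1 hi2, integral_const_mul,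
            integral_const_mul, integral_const_mul, hzero, hmean, mul_zero, add_zero]
      _ ≤ p * ((1 + η) * ∫ ω, G ω ∂μ
          - (1 - p) * θ / (2 * M) * (q * ∫ ω, G ω ∂μ)) := by gcongr
      _ = _ := by
          -- The gain is `2η` against an error `η`, so an attack contributes a net factor `1 - η`.
          have : (1 - p) * θ / (2 * M) * (q * ∫ ω, G ω ∂μ) = 2 * η * ∫ ω, G ω ∂μ := by
            rw [hη]; field_simp; ring
          rw [this]; ring
  have hsum : ∫ ω, G ω * Real.exp (-θ * normSlope (d ω) (w ω) - (1 - p) * θ / 2 * b ω) ∂μ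
      ≤ ∫ ω, ((1 - p) * (G ω * Real.exp (-(θ * ‖w ω‖))) + p * (1 - η) * G ω) ∂μ := by
    rw [← integral_add_compl hE hint_lhs, integral_add (hint_e.const_mul _) (hGi.const_mul _),
      integral_const_mul, integral_const_mul]
    linarith
  refine hsum.trans ?_
  rw [← integral_const_mul]
  refine integral_mono ((hint_e.const_mul _).add (hGi.const_mul _))
    ((hGmul 1 (by fun_prop) (hwexp (by positivity))).const_mul _) fun ω => ?_
  have hr : θ * ‖w ω‖ ≤ 1 / 2 := by
    have : θ * ‖w ω‖ ≤ θ * M := mul_le_mul_of_nonneg_left (hwM ω) hθ0.le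
    linarith
  have h1 := exp_neg_le_one_sub_half (mul_nonneg hθ0.le (norm_nonneg (w ω))) hr
  have h2 := Real.add_one_le_exp (-(p * η) + -((1 - p) * θ / 2 * ‖w ω‖))
  -- Linearizing the left exponential gives `1 - pη - (1-p)θ/2 ‖w‖`: the steps without attack pay
  -- back exactly the credit attached to `w`.
  have h3 : (1 - p) * Real.exp (-(θ * ‖w ω‖)) + p * (1 - η)
      ≤ Real.exp (-(p * η)) * Real.exp (-((1 - p) * θ / 2 * ‖w ω‖)) := by
    rw [← Real.exp_add]
    refine le_trans ?_ h2
    have := mul_le_mul_of_nonneg_left h1 hp1'.le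
    linarith
  have := mul_le_mul_of_nonneg_left h3 (hG0 ω)
  simp only
  linarith

end OneStep

/-! ### Exponential moments and concentration of the slope along the trajectory. -/

section Trajectory

variable {n m : ℕ} {Ω : Type*} {A : Matrix (Fin n) (Fin m) ℝ}
  {f : Vec n → Vec m} {d : ℕ → Ω → Vec n}

lemma state_succ (t : ℕ) (ω : Ω) :
    state A f d (t + 1) ω = matVec A (f (state A f d t ω)) + d t ω := rfl

lemma measurable_state_pastSigma {s t : ℕ} (h : s ≤ t) :
    Measurable[pastSigma A f d t] (state A f d s) :=
  (measurable_pi_apply (⟨s, Nat.lt_succ_of_le h⟩ : Fin (t + 1))).comp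
    (comap_measurable (history A f d t))

/-- Past attacks are recovered from consecutive states as `x_{s+1} - A f(x_s)`; the strict
inequality is needed because `x_{s+1}` must be observed. -/
lemma measurable_attack_pastSigma (hf : Measurable f) {s t : ℕ} (h : s < t) :
    Measurable[pastSigma A f d t] (d s) := by
  have : d s = fun ω => state A f d (s + 1) ω - matVec A (f (state A f d s ω)) := by
    funext ω; rw [state_succ]; abel
  rw [this]
  exact (measurable_state_pastSigma h).sub
    ((continuous_matVec A).measurable.comp (hf.comp (measurable_state_pastSigma h.le)))

/-- The sum over `s < t` of the slopes of the loss at `A` in the direction `D`. -/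
noncomputable def slopeSum (A : Matrix (Fin n) (Fin m) ℝ) (f : Vec n → Vec m)
    (d : ℕ → Ω → Vec n) (D : Matrix (Fin n) (Fin m) ℝ) (t : ℕ) (ω : Ω) : ℝ :=
  ∑ s ∈ Finset.range t, normSlope (d s ω) (matVec D (f (state A f d s ω)))

lemma measurable_slopeSum_pastSigma (hf : Measurable f) (D : Matrix (Fin n) (Fin m) ℝ) (t : ℕ) :
    Measurable[pastSigma A f d t] (slopeSum A f d D t) := by
  refine Finset.measurable_fun_sum _ fun s hs => ?_
  have hs := Finset.mem_range.1 hs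
  exact measurable_normSlope.comp ((measurable_attack_pastSigma hf hs).prodMk
    ((continuous_matVec D).measurable.comp (hf.comp (measurable_state_pastSigma hs.le))))

lemma slopeSum_sub_le {M : ℝ} (hM : ∀ x, ‖f x‖ ≤ M) (D D' : Matrix (Fin n) (Fin m) ℝ)
    (t : ℕ) (ω : Ω) :
    slopeSum A f d D t ω - slopeSum A f d D' t ω ≤ t * (‖D - D'‖ * M) := by
  unfold slopeSum
  rw [← Finset.sum_sub_distrib]
  calc _ ≤ ∑ _s ∈ Finset.range t, ‖D - D'‖ * M := Finset.sum_le_sum fun s _ => by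
        refine (normSlope_sub_le _ _ _).trans ?_
        rw [← matVec_sub_left]
        exact (norm_matVec_le _ _).trans (mul_le_mul_of_nonneg_left (hM _) (norm_nonneg _))
    _ = _ := by simp

lemma abs_slopeSum_le {M : ℝ} (hM : ∀ x, ‖f x‖ ≤ M) {D : Matrix (Fin n) (Fin m) ℝ}
    (hD : ‖D‖ = 1) (t : ℕ) (ω : Ω) : |slopeSum A f d D t ω| ≤ t * M := by
  unfold slopeSum
  calc _ ≤ ∑ _s ∈ Finset.range t, M := (Finset.abs_sum_le_sum_abs _ _).trans
        (Finset.sum_le_sum fun s _ => by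
          refine (abs_normSlope_le _ _).trans ((norm_matVec_le _ _).trans ?_)
          rw [hD, one_mul]
          exact hM _)
    _ = _ := by simp

variable [mΩ : MeasurableSpace Ω]

lemma measurable_state (hf : Measurable f) (hd : ∀ t, Measurable (d t)) (t : ℕ) :
    Measurable (state A f d t) := by
  induction t with
  | zero => exact measurable_const
  | succ t ih =>
    exact (((continuous_matVec A).measurable.comp (hf.comp ih)).add (hd t) :)

lemma measurable_history (hf : Measurable f) (hd : ∀ t, Measurable (d t)) (t : ℕ) :
    Measurable (history A f d t) :=
  measurable_pi_lambda _ fun s => measurable_state hf hd s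

lemma pastSigma_le (hf : Measurable f) (hd : ∀ t, Measurable (d t)) (t : ℕ) :
    pastSigma A f d t ≤ mΩ :=
  (measurable_history hf hd t).comap_le

variable {μ : Measure Ω} [IsProbabilityMeasure μ]

/-- Under the non-degeneracy condition, given the past and an attack, `E ‖D f(x_{t+1})‖²` is
at least `lam² ‖D‖²`. -/
lemma le_condExp_norm_matVec_sq (hf : Measurable f) (hd : ∀ t, Measurable (d t)) {B lam : ℝ}
    (hB : BoundedBasis f B) {T t : ℕ} (ht : t < T) (hne : μ (attackEvent d t) ≠ 0)
    (hnd : Nondegenerate μ A f d T lam) (hB0 : 0 ≤ B)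
    (D : Matrix (Fin n) (Fin m) ℝ) :
    ∀ᵐ ω ∂(μ[|attackEvent d t]), lam ^ 2 * ‖D‖ ^ 2 ≤
      ((μ[|attackEvent d t])[fun ω => ‖matVec D (f (state A f d (t + 1) ω))‖ ^ 2
        | pastSigma A f d t]) ω := by
  have : IsProbabilityMeasure (μ[|attackEvent d t]) := cond_isProbabilityMeasure hne
  let φ : (Fin (t + 1) → Vec n) × Vec n → ℝ := fun z =>
    ‖matVec D (f (matVec A (f (z.1 (Fin.last t))) + z.2))‖ ^ 2
  have hφ : Measurable φ := by
    have h1 : Measurable fun z : (Fin (t + 1) → Vec n) × Vec n => matVec A (f (z.1 (Fin.last t))) :=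
      (continuous_matVec A).measurable.comp
        (hf.comp ((measurable_pi_apply (Fin.last t)).comp measurable_fst))
    exact ((continuous_matVec D).measurable.comp (hf.comp (h1.add measurable_snd))).norm.pow_const 2
  have hφb : ∀ z, ‖φ z‖ ≤ (‖D‖ * (√m * B)) ^ 2 := by
    intro z
    rw [Real.norm_of_nonneg (sq_nonneg _)]
    exact pow_le_pow_left₀ (norm_nonneg _) ((norm_matVec_le _ _).trans
      (mul_le_mul_of_nonneg_left (norm_le_of_boundedBasis hB0 hB _) (norm_nonneg _))) 2
  have hhist := measurable_history (A := A) hf hd t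
  have hcond := condExp_prod_ae_eq_integral_condDistrib (μ := μ[|attackEvent d t]) (f := φ)
    hhist (hd t).aemeasurable hφ.stronglyMeasurable
    (Integrable.of_bound (hφ.comp (hhist.prodMk (hd t))).aestronglyMeasurable _
      (Filter.Eventually.of_forall fun ω => hφb _))
  have hprob : ∀ z, IsProbabilityMeasure (attackLaw μ A f d t z) := fun z => by
    unfold attackLaw; infer_instance
  filter_upwards [hcond, hnd t ht] with ω h1 h2
  -- Non-degeneracy is used at the random point `x = A f(x_t)`; this is allowed because the
  -- quantifier over `x` stands inside the almost sure event.
  have h3 := mul_norm_sq_le_integral_matVec hf hB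
    (attackLaw μ A f d t (history A f d t ω)) (matVec A (f (state A f d t ω))) (h2 _) D
  exact h3.trans_eq h1.symm

/-- The exponential moment of the slope decreases geometrically. -/
lemma integral_exp_slopeSum_le (hf : Measurable f) (hd : ∀ t, Measurable (d t))
    {p B lam M : ℝ} {T : ℕ} (hp0 : 0 < p) (hp1 : p < 1) (hB0 : 0 ≤ B) (hlam : 0 < lam)
    (hM0 : 0 < M) (hlM : lam ^ 2 ≤ M ^ 2) (hfM : ∀ x, ‖f x‖ ≤ M)
    (hpa : ProbabilisticAttack μ A f d T p) (hB : BoundedBasis f B) (hst : Stealthy μ A f d T)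
    (hnd : Nondegenerate μ A f d T lam) {D : Matrix (Fin n) (Fin m) ℝ} (hD : ‖D‖ = 1)
    {θ η : ℝ} (hθ : θ = (1 - p) * lam ^ 2 / (12 * M ^ 3))
    (hη : η = (1 - p) * θ * lam ^ 2 / (4 * M)) :
    ∀ t ≤ T, ∫ ω, Real.exp (-θ * slopeSum A f d D t ω
      - (1 - p) * θ / 2 * ‖matVec D (f (state A f d t ω))‖) ∂μ ≤ Real.exp (-(p * η) * t) := by
  have hp1' : 0 < 1 - p := by linarith
  have hθ0 : 0 < θ := by rw [hθ]; positivity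
  have hw : ∀ s ω, ‖matVec D (f (state A f d s ω))‖ ≤ M := fun s ω => by
    refine (norm_matVec_le _ _).trans ?_
    rw [hD, one_mul]
    exact hfM _
  have hwm : ∀ t, Measurable fun ω => matVec D (f (state A f d t ω)) := fun t =>
    (continuous_matVec D).measurable.comp (hf.comp (measurable_state hf hd t))
  intro t
  induction t with
  | zero =>
    intro _
    calc _ ≤ ∫ _ω, (1 : ℝ) ∂μ := by
          refine integral_mono_of_nonneg (Filter.Eventually.of_forall fun ω => (Real.exp_pos _).le)
            (integrable_const _) (Filter.Eventually.of_forall fun ω => ?_)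
          simp only [slopeSum, Finset.range_zero, Finset.sum_empty, mul_zero, zero_sub]
          rw [Real.exp_le_one_iff, neg_nonpos]
          positivity
      _ = _ := by simp
  | succ t ih =>
    intro ht
    have htT : t < T := ht
    have hpt := hpa.prob_eq t htT
    have hne : μ (attackEvent d t) ≠ 0 := fun h => by
      rw [Measure.real, h] at hpt
      simp at hpt
      linarith
    have hstep := integral_mul_exp_normSlope_le (μ := μ) (pastSigma_le (A := A) hf hd t)
      (d := d t) (w := fun ω => matVec D (f (state A f d t ω)))
      (G := fun ω => Real.exp (-θ * slopeSum A f d D t ω))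
      (b := fun ω => ‖matVec D (f (state A f d (t + 1) ω))‖)
      (K := Real.exp (θ * (t * M))) hp0 hp1 hM0 (pow_pos hlam 2) hlM (hd t)
      ((continuous_matVec D).measurable.comp
        (hf.comp (measurable_state_pastSigma le_rfl))).stronglyMeasurable
      (((measurable_slopeSum_pastSigma hf D t).const_mul (-θ)).exp).stronglyMeasurable
      (hwm (t + 1)).norm (fun ω => (Real.exp_pos _).le)
      (fun ω => by
        rw [Real.exp_le_exp]
        have := (abs_le.1 (abs_slopeSum_le (A := A) (d := d) hfM hD t ω)).1
        nlinarith)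
      (hw t) (fun ω => norm_nonneg _) (hw (t + 1)) hpt (hpa.indep_past t htT) (hst t htT)
      (by
        have := le_condExp_norm_matVec_sq (A := A) hf hd hB htT hne hnd hB0 D
        rw [hD, one_pow, mul_one] at this
        exact this) hθ hη
    calc _ = ∫ ω, Real.exp (-θ * slopeSum A f d D t ω)
          * Real.exp (-θ * normSlope (d t ω) (matVec D (f (state A f d t ω)))
            - (1 - p) * θ / 2 * ‖matVec D (f (state A f d (t + 1) ω))‖) ∂μ := by
          congr 1
          funext ω
          rw [← Real.exp_add, slopeSum, Finset.sum_range_succ, ← slopeSum]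
          congr 1
          ring
      _ ≤ _ := hstep
      _ = Real.exp (-(p * η)) * ∫ ω, Real.exp (-θ * slopeSum A f d D t ω
            - (1 - p) * θ / 2 * ‖matVec D (f (state A f d t ω))‖) ∂μ := by
          simp only [← Real.exp_add, ← sub_eq_add_neg]
      _ ≤ Real.exp (-(p * η)) * Real.exp (-(p * η) * t) :=
          mul_le_mul_of_nonneg_left (ih htT.le) (Real.exp_pos _).le
      _ = _ := by
          rw [← Real.exp_add]
          push_cast
          congr 1
          ring

/-- In a fixed direction, the slope of the loss is large with high probability. -/
lemma measureReal_slopeSum_le (hf : Measurable f) (hd : ∀ t, Measurable (d t))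
    {p B lam M : ℝ} {T : ℕ} (hp0 : 0 < p) (hp1 : p < 1) (hB0 : 0 ≤ B) (hlam : 0 < lam)
    (hM0 : 0 < M) (hlM : lam ^ 2 ≤ M ^ 2) (hfM : ∀ x, ‖f x‖ ≤ M)
    (hpa : ProbabilisticAttack μ A f d T p) (hB : BoundedBasis f B) (hst : Stealthy μ A f d T)
    (hnd : Nondegenerate μ A f d T lam) {D : Matrix (Fin n) (Fin m) ℝ} (hD : ‖D‖ = 1) :
    μ.real {ω | slopeSum A f d D T ω ≤ p * (1 - p) * lam ^ 2 / (8 * M) * T} ≤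
      Real.exp (1 - p * (1 - p) ^ 2 * lam ^ 4 / (96 * M ^ 4) * T) := by
  have hp1' : 0 < 1 - p := by linarith
  obtain ⟨θ, hθ⟩ : ∃ θ, θ = (1 - p) * lam ^ 2 / (12 * M ^ 3) := ⟨_, rfl⟩
  obtain ⟨η, hη⟩ : ∃ η, η = (1 - p) * θ * lam ^ 2 / (4 * M) := ⟨_, rfl⟩
  have hθ0 : 0 < θ := by rw [hθ]; positivity
  have hmain := integral_exp_slopeSum_le (A := A) hf hd hp0 hp1 hB0 hlam hM0 hlM hfM hpa hB hst hnd
    hD hθ hη T le_rfl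
  have hsm : Measurable (slopeSum A f d D T) :=
    (measurable_slopeSum_pastSigma hf D T).mono (pastSigma_le hf hd T) le_rfl
  have hw : ∀ ω, ‖matVec D (f (state A f d T ω))‖ ≤ M := fun ω => by
    refine (norm_matVec_le _ _).trans ?_
    rw [hD, one_mul]
    exact hfM _
  have hwm : Measurable fun ω => matVec D (f (state A f d T ω)) :=
    (continuous_matVec D).measurable.comp (hf.comp (measurable_state hf hd T))
  have hbound : ∀ ω, -θ * slopeSum A f d D T ω ≤ θ * (T * M) := fun ω => by
    have := (abs_le.1 (abs_slopeSum_le (A := A) (d := d) hfM hD T ω)).1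
    nlinarith
  have hint : Integrable (fun ω => Real.exp (-θ * slopeSum A f d D T ω)) μ := by
    refine Integrable.of_bound (C := Real.exp (θ * (T * M)))
      ((hsm.const_mul _).exp).aestronglyMeasurable (Filter.Eventually.of_forall fun ω => ?_)
    rw [Real.norm_of_nonneg (Real.exp_pos _).le]
    exact Real.exp_le_exp.2 (hbound ω)
  have hint' : Integrable (fun ω => Real.exp (-θ * slopeSum A f d D T ω
      - (1 - p) * θ / 2 * ‖matVec D (f (state A f d T ω))‖)) μ := by
    refine Integrable.of_bound (C := Real.exp (θ * (T * M)))
      (((hsm.const_mul _).sub (hwm.norm.const_mul _)).exp).aestronglyMeasurable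
      (Filter.Eventually.of_forall fun ω => ?_)
    rw [Real.norm_of_nonneg (Real.exp_pos _).le]
    refine Real.exp_le_exp.2 (le_trans ?_ (hbound ω))
    have : 0 ≤ (1 - p) * θ / 2 * ‖matVec D (f (state A f d T ω))‖ := by positivity
    linarith
  -- Removing the credit left at the horizon costs at most a factor `exp 1`, the `1` in the final
  -- exponent.
  have hlast : (1 - p) * θ / 2 * M ≤ 1 := by
    have : (1 - p) * θ / 2 * M = (1 - p) ^ 2 * (lam ^ 2 / M ^ 2) / 24 := by
      rw [hθ]; field_simp; ring
    rw [this]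
    have h1 : lam ^ 2 / M ^ 2 ≤ 1 := by rw [div_le_one (by positivity)]; exact hlM
    have h2 : (1 - p) ^ 2 ≤ 1 := by nlinarith
    have h3 : (1 - p) ^ 2 * (lam ^ 2 / M ^ 2) ≤ 1 := mul_le_one₀ h2 (by positivity) h1
    linarith
  have hmgf : mgf (slopeSum A f d D T) μ (-θ) ≤ Real.exp 1 * Real.exp (-(p * η) * T) := by
    refine le_trans ?_ (mul_le_mul_of_nonneg_left hmain (Real.exp_pos 1).le)
    rw [mgf, ← integral_const_mul]
    refine integral_mono hint (hint'.const_mul _) fun ω => ?_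
    simp only [← Real.exp_add]
    refine Real.exp_le_exp.2 ?_
    have : (1 - p) * θ / 2 * ‖matVec D (f (state A f d T ω))‖ ≤ (1 - p) * θ / 2 * M :=
      mul_le_mul_of_nonneg_left (hw ω) (by positivity)
    linarith
  -- With this threshold `θ` times it equals `pηT / 2`, half of the available decay; the other half
  -- is the stated rate.
  have hchernoff := measure_le_le_exp_mul_mgf (μ := μ) (X := slopeSum A f d D T) (t := -θ)
    (p * (1 - p) * lam ^ 2 / (8 * M) * T) (by linarith) hint
  refine (hchernoff.trans (mul_le_mul_of_nonneg_left hmgf (Real.exp_pos _).le)).trans_eq ?_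
  rw [← Real.exp_add, ← Real.exp_add]
  congr 1
  rw [hη, hθ]
  field_simp
  ring

end Trajectory

/-! ### Union bound over directions and the sample complexity. -/

section Recovery

variable {n m : ℕ} {Ω : Type*} [MeasurableSpace Ω] {μ : Measure Ω} [IsProbabilityMeasure μ]
  {A : Matrix (Fin n) (Fin m) ℝ} {f : Vec n → Vec m} {d : ℕ → Ω → Vec n}

/-- The non-degeneracy constant is at most the bound on the basis functions. -/
lemma le_of_nondegenerate (hf : Measurable f) {p B lam : ℝ} {T : ℕ} (hm : 0 < m) (hT : 0 < T)
    (hp0 : 0 < p) (hB0 : 0 ≤ B) (hpa : ProbabilisticAttack μ A f d T p)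
    (hB : BoundedBasis f B) (hnd : Nondegenerate μ A f d T lam) : lam ≤ B := by
  have hne : μ (attackEvent d 0) ≠ 0 := fun h => by
    have := hpa.prob_eq 0 hT
    rw [Measure.real, h] at this
    simp at this
    linarith
  have : IsProbabilityMeasure (μ[|attackEvent d 0]) := cond_isProbabilityMeasure hne
  obtain ⟨ω, hω⟩ := (hnd 0 hT).exists
  have : IsProbabilityMeasure (attackLaw μ A f d 0 (history A f d 0 ω)) := by
    unfold attackLaw; infer_instance
  exact le_of_pow_le_pow_left₀ two_ne_zero hB0 (le_sq_of_le_spectrum_secondMoment hf hB _ 0 (hω 0) ⟨0, hm⟩)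

/-- A union bound over a net of directions gives exact recovery with high probability. -/
lemma one_sub_le_measureReal_isUniqueGlobalMin (hf : Measurable f) (hd : ∀ t, Measurable (d t))
    {p B lam M : ℝ} {T : ℕ} (hT : 0 < T) (hp0 : 0 < p) (hp1 : p < 1) (hB0 : 0 ≤ B)
    (hlam : 0 < lam) (hM0 : 0 < M) (hlM : lam ^ 2 ≤ M ^ 2) (hfM : ∀ x, ‖f x‖ ≤ M)
    (hpa : ProbabilisticAttack μ A f d T p) (hB : BoundedBasis f B) (hst : Stealthy μ A f d T)
    (hnd : Nondegenerate μ A f d T lam) :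
    1 - (24 * M ^ 2 / (p * (1 - p) * lam ^ 2)) ^ (n * m)
        * Real.exp (1 - p * (1 - p) ^ 2 * lam ^ 4 / (96 * M ^ 4) * T) ≤
      μ.real {ω | IsUniqueGlobalMin (loss f (fun t => state A f d t ω) T) A} := by
  have hp1' : 0 < 1 - p := by linarith
  -- Chosen so that the Lipschitz error `T ε M` equals the Chernoff threshold.
  obtain ⟨ε, hε⟩ : ∃ ε, ε = p * (1 - p) * lam ^ 2 / (8 * M ^ 2) := ⟨_, rfl⟩
  have hε0 : 0 < ε := by rw [hε]; positivity
  have hε1 : ε ≤ 1 := by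
    have : ε = p * (1 - p) * (lam ^ 2 / M ^ 2) / 8 := by rw [hε]; field_simp
    rw [this]
    have h1 : lam ^ 2 / M ^ 2 ≤ 1 := by rw [div_le_one (by positivity)]; exact hlM
    have h2 : p * (1 - p) ≤ 1 := by nlinarith
    have h3 : p * (1 - p) * (lam ^ 2 / M ^ 2) ≤ 1 := mul_le_one₀ h2 (by positivity) h1
    linarith
  obtain ⟨s, hs1, hsnet, hscard⟩ :=
    exists_finset_net_sphere (Matrix (Fin n) (Fin m) ℝ) hε0 hε1
  have hdim : Module.finrank ℝ (Matrix (Fin n) (Fin m) ℝ) = n * m := by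
    simp [Module.finrank_matrix]
  have h3ε : 3 / ε = 24 * M ^ 2 / (p * (1 - p) * lam ^ 2) := by
    rw [hε]; field_simp; norm_num
  rw [hdim, h3ε] at hscard
  let bad : Set Ω := ⋃ D ∈ s, {ω | slopeSum A f d D T ω ≤ p * (1 - p) * lam ^ 2 / (8 * M) * T}
  have hbad : MeasurableSet bad := by
    refine Finset.measurableSet_biUnion _ fun D _ => measurableSet_le ?_ measurable_const
    exact (measurable_slopeSum_pastSigma hf D T).mono (pastSigma_le hf hd T) le_rfl
  have hgood : badᶜ ⊆ {ω | IsUniqueGlobalMin (loss f (fun t => state A f d t ω) T) A} := by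
    intro ω hω
    refine isUniqueGlobalMin_loss A f (fun t => d t ω) T fun D hD => ?_
    obtain ⟨D', hD's, hDD'⟩ := hsnet D hD
    have h1 : p * (1 - p) * lam ^ 2 / (8 * M) * T < slopeSum A f d D' T ω := by
      simp only [bad, Set.mem_compl_iff, Set.mem_iUnion, Set.mem_ofPred_eq, not_exists,
        not_le] at hω
      exact hω D' hD's
    have h2 := slopeSum_sub_le (A := A) (d := d) hfM D' D T ω
    rw [norm_sub_rev] at h2
    have h3 : (T : ℝ) * (‖D - D'‖ * M) ≤ T * (ε * M) := by gcongr
    have h4 : (T : ℝ) * (ε * M) = p * (1 - p) * lam ^ 2 / (8 * M) * T := by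
      rw [hε]; field_simp
    have h5 : 0 < slopeSum A f d D T ω := by linarith
    exact h5
  have hunion : μ.real bad ≤ (24 * M ^ 2 / (p * (1 - p) * lam ^ 2)) ^ (n * m)
        * Real.exp (1 - p * (1 - p) ^ 2 * lam ^ 4 / (96 * M ^ 4) * T) := by
    calc μ.real bad ≤ ∑ D ∈ s,
          μ.real {ω | slopeSum A f d D T ω ≤ p * (1 - p) * lam ^ 2 / (8 * M) * T} :=
          measureReal_biUnion_finset_le _ _
      _ ≤ ∑ _D ∈ s, Real.exp (1 - p * (1 - p) ^ 2 * lam ^ 4 / (96 * M ^ 4) * T) :=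
          Finset.sum_le_sum fun D hDs => measureReal_slopeSum_le hf hd hp0 hp1 hB0 hlam hM0 hlM
            hfM hpa hB hst hnd (hs1 D hDs)
      _ = s.card * Real.exp (1 - p * (1 - p) ^ 2 * lam ^ 4 / (96 * M ^ 4) * T) := by simp
      _ ≤ _ := mul_le_mul_of_nonneg_right hscard (Real.exp_pos _).le
  calc _ ≤ 1 - μ.real bad := by linarith
    _ = μ.real badᶜ := by rw [probReal_compl_eq_one_sub hbad]
    -- Monotonicity requires no measurability of the recovery event.
    _ ≤ _ := measureReal_mono hgood

/-- The horizon in the sample complexity bound makes the failure probability at most `δ`. -/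
lemma pow_mul_exp_le_of_horizon {n m : ℕ} (hn : 0 < n) (hm : 0 < m) {p κ δ τ : ℝ} (hp0 : 0 < p)
    (hp1 : p < 1) (hκ : 1 ≤ κ) (hδ : 0 < δ)
    (hτ : 576 * ((m : ℝ) ^ 2 * κ ^ 4 / (p * (1 - p) ^ 2) *
      ((m : ℝ) * n * Real.log (m * κ / (p * (1 - p))) + Real.log (1 / δ))) ≤ τ) (hδ1 : δ ≤ 1) :
    (24 * (m * κ ^ 2) / (p * (1 - p))) ^ (n * m)
      * Real.exp (1 - p * (1 - p) ^ 2 / (96 * ((m : ℝ) ^ 2 * κ ^ 4)) * τ) ≤ δ := by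
  have hp1' : 0 < 1 - p := by linarith
  have hm1 : (1 : ℝ) ≤ m := by exact_mod_cast hm
  have hn1 : (1 : ℝ) ≤ n := by exact_mod_cast hn
  obtain ⟨L, hL⟩ : ∃ L, L = m * κ / (p * (1 - p)) := ⟨_, rfl⟩
  rw [← hL] at hτ
  have hpp : 0 < p * (1 - p) := by positivity
  have hL4 : 4 ≤ L := by
    rw [hL, le_div_iff₀ hpp]
    -- `p(1-p) ≤ 1/4` and `mκ ≥ 1`.
    nlinarith [sq_nonneg (p - 1 / 2), one_le_mul_of_one_le_of_one_le hm1 hκ]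
  -- The covering base is `24 L κ`, where `24 ≤ 4³ ≤ L³` and `κ ≤ L`.
  have hbase : 24 * (m * κ ^ 2) / (p * (1 - p)) ≤ L ^ 5 := by
    have h1 : 24 * (m * κ ^ 2) / (p * (1 - p)) = 24 * (L * κ) := by rw [hL]; ring
    have h2 : κ ≤ L := by
      rw [hL, le_div_iff₀ hpp]
      have : p * (1 - p) ≤ 1 := by nlinarith
      nlinarith
    have h3 : (4 : ℝ) ^ 3 ≤ L ^ 3 := pow_le_pow_left₀ (by norm_num) hL4 3
    have hL0 : 0 < L := by linarith
    calc _ = 24 * (L * κ) := h1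
      _ ≤ L ^ 3 * (L * L) := by gcongr; linarith
      _ = L ^ 5 := by ring
  have hlog : 1 ≤ Real.log L := by
    rw [Real.le_log_iff_exp_le (by linarith)]
    linarith [Real.exp_one_lt_d9]
  have hmn : (1 : ℝ) ≤ m * n * Real.log L :=
    one_le_mul_of_one_le_of_one_le (one_le_mul_of_one_le_of_one_le hm1 hn1) hlog
  have hpow : (24 * (m * κ ^ 2) / (p * (1 - p))) ^ (n * m)
      ≤ Real.exp (5 * (m * n * Real.log L)) := by
    calc _ ≤ (L ^ 5) ^ (n * m) := pow_le_pow_left₀ (by positivity) hbase _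
      _ = Real.exp (Real.log ((L ^ 5) ^ (n * m))) :=
          (Real.exp_log (by have : 0 < L := by linarith
                            positivity)).symm
      _ = _ := by
          rw [Real.log_pow, Real.log_pow]
          push_cast
          congr 1
          ring
  have hlδ : 0 ≤ Real.log (1 / δ) := Real.log_nonneg (by rw [le_div_iff₀ hδ]; linarith)
  -- Five of the six units pay for the net; the sixth is at least `1` and absorbs the additive
  -- constant in the exponent.
  have hrate : 6 * (m * n * Real.log L) + 6 * Real.log (1 / δ)
      ≤ p * (1 - p) ^ 2 / (96 * ((m : ℝ) ^ 2 * κ ^ 4)) * τ := by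
    calc _ = p * (1 - p) ^ 2 / (96 * ((m : ℝ) ^ 2 * κ ^ 4))
          * (576 * ((m : ℝ) ^ 2 * κ ^ 4 / (p * (1 - p) ^ 2) *
            ((m : ℝ) * n * Real.log L + Real.log (1 / δ)))) := by
          field_simp; ring
      _ ≤ _ := mul_le_mul_of_nonneg_left hτ (by positivity)
  calc _ ≤ Real.exp (5 * (m * n * Real.log L))
        * Real.exp (1 - p * (1 - p) ^ 2 / (96 * ((m : ℝ) ^ 2 * κ ^ 4)) * τ) :=
        mul_le_mul_of_nonneg_right hpow (Real.exp_pos _).le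
    _ = Real.exp (5 * (m * n * Real.log L)
        + (1 - p * (1 - p) ^ 2 / (96 * ((m : ℝ) ^ 2 * κ ^ 4)) * τ)) := (Real.exp_add _ _).symm
    _ ≤ Real.exp (-Real.log (1 / δ)) := Real.exp_le_exp.2 (by linarith)
    _ = δ := by rw [one_div, Real.log_inv, neg_neg, Real.exp_log hδ]

end Recovery

end ExactRecovery

theorem theorem3 :
    ∃ C : ℝ, 0 < C ∧
      ∀ {Ω : Type*} [MeasurableSpace Ω] (μ : Measure Ω) [IsProbabilityMeasure μ]
        (n m T : ℕ) (_hn : 0 < n) (_hm : 0 < m) (_hT : 0 < T)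
        (A : Matrix (Fin n) (Fin m) ℝ) (f : Vec n → Vec m) (_hf : Measurable f)
        (d : ℕ → Ω → Vec n) (_hd : ∀ t, Measurable (d t))
        (p B lam : ℝ) (_hp0 : 0 < p) (_hp1 : p < 1) (_hB : 0 < B) (_hlam : 0 < lam),
        ProbabilisticAttack μ A f d T p →
        BoundedBasis f B →
        Stealthy μ A f d T →
        Nondegenerate μ A f d T lam →
        1 ≤ B / lam ∧
        ∀ δ : ℝ, 0 < δ → δ ≤ 1 →
          C * ((m : ℝ) ^ 2 * (B / lam) ^ 4 / (p * (1 - p) ^ 2) *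
            ((m : ℝ) * (n : ℝ) * Real.log ((m : ℝ) * (B / lam) / (p * (1 - p)))
              + Real.log (1 / δ))) ≤ (T : ℝ) →
          1 - δ ≤ μ.real
            {ω | IsUniqueGlobalMin (loss f (fun t => state A f d t ω) T) A} := by
  -- `576 = 6 · 96`: the rate denominator `96` times the six units spent in
  -- `pow_mul_exp_le_of_horizon`.
  refine ⟨576, by norm_num, ?_⟩
  intro Ω _ μ _ n m T hn hm hT A f hf d hd p B lam hp0 hp1 hB hlam hpa hbb hst hnd
  have hlB : lam ≤ B := le_of_nondegenerate hf hm hT hp0 hB.le hpa hbb hnd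
  have hκ : 1 ≤ B / lam := (one_le_div hlam).2 hlB
  refine ⟨hκ, fun δ hδ hδ1 hhor => ?_⟩
  have hp1' : 0 < 1 - p := by linarith
  have hm0 : (0 : ℝ) < m := by exact_mod_cast hm
  have hm1 : (1 : ℝ) ≤ m := by exact_mod_cast hm
  have hMsq : (√m * B) ^ 2 = m * B ^ 2 := by rw [mul_pow, Real.sq_sqrt hm0.le]
  have hMfour : (√m * B) ^ 4 = m ^ 2 * B ^ 4 := by
    calc (√m * B) ^ 4 = ((√m * B) ^ 2) ^ 2 := by ring
      _ = _ := by rw [hMsq]; ring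
  have hlM : lam ^ 2 ≤ (√m * B) ^ 2 := by
    rw [hMsq]
    have : lam ^ 2 ≤ B ^ 2 := pow_le_pow_left₀ hlam.le hlB 2
    nlinarith [sq_nonneg B]
  have hrec := one_sub_le_measureReal_isUniqueGlobalMin (μ := μ) (A := A) hf hd hT hp0 hp1 hB.le
    hlam (M := √m * B) (by positivity) hlM (norm_le_of_boundedBasis hB.le hbb) hpa hbb hst hnd
  have hfail := pow_mul_exp_le_of_horizon hn hm hp0 hp1 hκ hδ hhor hδ1
  refine le_trans ?_ hrec
  have h1 : 24 * (√m * B) ^ 2 / (p * (1 - p) * lam ^ 2)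
      = 24 * (m * (B / lam) ^ 2) / (p * (1 - p)) := by
    rw [hMsq]; field_simp
  have h2 : p * (1 - p) ^ 2 * lam ^ 4 / (96 * (√m * B) ^ 4)
      = p * (1 - p) ^ 2 / (96 * ((m : ℝ) ^ 2 * (B / lam) ^ 4)) := by
    rw [hMfour]; field_simp
  rw [h1, h2]
  linarith
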